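/- A weighted graph $G$ on a finite node set $V$ has nodeweights $\alpha_i(G)>0$ ($i\in V$) and symmetric real edgeweights $\beta_{ij}(G)=\beta_{ji}(G)$ ($i,j\in V$, loops $i=j$ allowed, $\beta_{ij}(G)=0$ if $ij$ is not an edge). Put $\alpha_G=\sum_{i}\alpha_i(G)$ and $e_G(S,T)=\sum_{i\in S,\,j\in T}\alpha_i(G)\alpha_j(G)\beta_{ij}(G)$ for $S,T\subseteq V$. For two weighted graphs $G,H$ on the same node set $V$ with the same nodeweights (here nodeweights $0$ are allowed too), let $$d_\square(G,H)=\max_{S,T\subseteq V}\frac{1}{\alpha_G^2}\bigl|e_G(S,T)-e_H(S,T)\bigr| .$$ For weighted graphs $G,G'$ with the same number of nodes and with all nodeweights equal to $1$, let $\widehat\delta_\square(G,G')=\min_{\widetilde G}d_\square(\widetilde G,G')$, where $\widetilde G$ runs over all graphs on the node set of $G'$ obtained from $G$ by relabeling its nodes along a bijection $V(G)\to V(G')$. For weighted graphs $G,G'$, a fractional overlay is a nonnegative matrix $X=(X_{iu})_{i\in V(G),\,u\in V(G')}$ with $\sum_u X_{iu}=\alpha_i(G)/\alpha_G$ for all $i$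 and $\sum_i X_{iu}=\alpha_u(G')/\alpha_{G'}$ for all $u$. Let $G[X]$ and $G'[X^\top]$ be the graphs on $V(G)\times V(G')$ in both of which the node $(i,u)$ has weight $X_{iu}$, and in which the edge $((i,u),(j,v))$ has weight $\beta_{ij}(G)$ and $\beta_{uv}(G')$, respectively. Let $\delta_\square(G,G')=\min_X d_\square(G[X],G'[X^\top])$, the minimum being over all fractional overlays $X$. **Theorem 2.1.** Let $G_1$ and $G_2$ be two weighted graphs with the same number of nodes, with all nodeweights equal to $1$ and all edgeweights in $[-1,1]$. Then $$\delta_\square(G_1,G_2)\le\widehat\delta_\square(G_1,G_2)\le 32\,\delta_\square(G_1,G_2)^{1/67}.$$ -/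

import Mathlib

noncomputable section

/-- A weighted graph on the finite node set `V`, with loops allowed. The edges are undirected, so
the edgeweights are symmetric, and a non-edge has weight `0`. Nodeweights are only required to be
nonnegative, because the overlaid graphs `G[X]` below may have nodes of weight `0`. -/
structure WeightedGraph (V : Type*) where
  nodeWeight : V → ℝ
  edgeWeight : V → V → ℝ
  nodeWeight_nonneg : ∀ i, 0 ≤ nodeWeight i
  edgeWeight_symm : ∀ i j, edgeWeight i j = edgeWeight j i

namespace WeightedGraph

variable {V V' : Type*}

/-- The nodes are unweighted: all nodeweights are `1`. -/
def HasUnweightedNodes (G : WeightedGraph V) : Prop :=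
  ∀ i, G.nodeWeight i = 1

/-- The total nodeweight `α_G`. -/
def totalWeight [Fintype V] (G : WeightedGraph V) : ℝ :=
  ∑ i, G.nodeWeight i

/-- `e_G(S, T) = ∑_{i ∈ S, j ∈ T} α_i α_j β_{ij}`. -/
def cutWeight (G : WeightedGraph V) (S T : Finset V) : ℝ :=
  ∑ i ∈ S, ∑ j ∈ T, G.nodeWeight i * G.nodeWeight j * G.edgeWeight i j

/-- The labeled cut distance `d_□(G, H) = max_{S, T ⊆ V} |e_G(S, T) - e_H(S, T)| / α_G²` of two
weighted graphs on the same node set with the same nodeweights (it is only used for such pairs).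
The supremum is a maximum over a finite nonempty set. -/
def cutDist [Fintype V] (G H : WeightedGraph V) : ℝ :=
  ⨆ p : Finset V × Finset V, |G.cutWeight p.1 p.2 - H.cutWeight p.1 p.2| / G.totalWeight ^ 2

/-- The graph obtained from `G` by renaming each node `i` to `σ i`. -/
def relabel (G : WeightedGraph V) (σ : V ≃ V') : WeightedGraph V' where
  nodeWeight u := G.nodeWeight (σ.symm u)
  edgeWeight u v := G.edgeWeight (σ.symm u) (σ.symm v)
  nodeWeight_nonneg _ := G.nodeWeight_nonneg _
  edgeWeight_symm _ _ := G.edgeWeight_symm _ _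

/-- The integer-overlay distance: the minimum of `d_□(G̃, G')` over all relabelings `G̃` of `G`
on the node set of `G'`. The node sets should have the same number of nodes, so that the infimum is
a minimum over a finite nonempty set. -/
def integerOverlayDist [Fintype V'] (G : WeightedGraph V) (G' : WeightedGraph V') : ℝ :=
  ⨅ σ : V ≃ V', cutDist (G.relabel σ) G'

/-- The graph obtained from `G` by dividing all nodeweights by the total nodeweight. -/
def normalize [Fintype V] (G : WeightedGraph V) : WeightedGraph V where
  nodeWeight i := G.nodeWeight i / G.totalWeight
  edgeWeight := G.edgeWeight
  nodeWeight_nonneg i :=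
    div_nonneg (G.nodeWeight_nonneg i) (Finset.sum_nonneg fun j _ => G.nodeWeight_nonneg j)
  edgeWeight_symm := G.edgeWeight_symm

/-- A fractional overlay of `G` and `G'`: a coupling `X` of the nodeweights of `G` and `G'`
(meant for graphs of total nodeweight `1`). -/
structure FractionalOverlay [Fintype V] [Fintype V'] (G : WeightedGraph V)
    (G' : WeightedGraph V') where
  X : Matrix V V' ℝ
  nonneg : ∀ i u, 0 ≤ X i u
  row_sum : ∀ i, ∑ u, X i u = G.nodeWeight i
  col_sum : ∀ u, ∑ i, X i u = G'.nodeWeight u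

namespace FractionalOverlay

variable [Fintype V] [Fintype V'] {G : WeightedGraph V} {G' : WeightedGraph V'}

/-- The overlaid graph `G[X]` on `V × V'`: node `(i, u)` has weight `X i u`, and the edge
`((i, u), (j, v))` has the weight of the edge `(i, j)` of `G`. -/
def overlaidLeft (O : FractionalOverlay G G') : WeightedGraph (V × V') where
  nodeWeight p := O.X p.1 p.2
  edgeWeight p q := G.edgeWeight p.1 q.1
  nodeWeight_nonneg p := O.nonneg p.1 p.2
  edgeWeight_symm p q := G.edgeWeight_symm p.1 q.1

/-- The overlaid graph `G'[Xᵀ]` on `V × V'`: node `(i, u)` has weight `X i u`, and the edge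
`((i, u), (j, v))` has the weight of the edge `(u, v)` of `G'`. -/
def overlaidRight (O : FractionalOverlay G G') : WeightedGraph (V × V') where
  nodeWeight p := O.X p.1 p.2
  edgeWeight p q := G'.edgeWeight p.2 q.2
  nodeWeight_nonneg p := O.nonneg p.1 p.2
  edgeWeight_symm p q := G'.edgeWeight_symm p.2 q.2

end FractionalOverlay

/-- The fractional-overlay distance: the minimum of `d_□(G[X], G'[Xᵀ])` over all fractional overlays
of the normalized graphs. (For graphs of positive total nodeweight the overlays form a nonempty
compact set on which this distance is continuous, so the infimum is a minimum.) -/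
def fractionalOverlayDist [Fintype V] [Fintype V'] (G : WeightedGraph V)
    (G' : WeightedGraph V') : ℝ :=
  ⨅ O : FractionalOverlay G.normalize G'.normalize, cutDist O.overlaidLeft O.overlaidRight

end WeightedGraph

end

/-- The quadrilinear form with coefficients `K`. -/
def quarticForm {α : Type*} [Fintype α] (K : α → α → α → α → ℝ) (x y z w : α → ℝ) : ℝ :=
  ∑ a, ∑ b, ∑ c, ∑ d, K a b c d * (x a * y b * z c * w d)

/-- The `ℓ¹`-norm of a function on a finite type. -/
def l1Norm {α : Type*} [Fintype α] (x : α → ℝ) : ℝ := ∑ a, |x a|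

section QuarticForm

variable {α : Type*} [Fintype α]

lemma l1Norm_nonneg (x : α → ℝ) : 0 ≤ l1Norm x := Finset.sum_nonneg fun _ _ => abs_nonneg _

lemma l1Norm_eq_sum {x : α → ℝ} (hx : ∀ a, 0 ≤ x a) : l1Norm x = ∑ a, x a :=
  Finset.sum_congr rfl fun a _ => abs_of_nonneg (hx a)

lemma l1Norm_sub_le (x y : α → ℝ) : l1Norm (x - y) ≤ l1Norm x + l1Norm y := by
  unfold l1Norm
  rw [← Finset.sum_add_distrib]
  exact Finset.sum_le_sum fun a _ => abs_sub (x a) (y a)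

variable (K : α → α → α → α → ℝ)

lemma quarticForm_add₁ (x x' y z w : α → ℝ) :
    quarticForm K (x + x') y z w = quarticForm K x y z w + quarticForm K x' y z w := by
  simp only [quarticForm, ← Finset.sum_add_distrib, Pi.add_apply]
  refine Finset.sum_congr rfl fun a _ => Finset.sum_congr rfl fun b _ =>
    Finset.sum_congr rfl fun c _ => Finset.sum_congr rfl fun d _ => by ring

lemma quarticForm_add₂ (x y y' z w : α → ℝ) :
    quarticForm K x (y + y') z w = quarticForm K x y z w + quarticForm K x y' z w := by
  simp only [quarticForm, ← Finset.sum_add_distrib, Pi.add_apply]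
  refine Finset.sum_congr rfl fun a _ => Finset.sum_congr rfl fun b _ =>
    Finset.sum_congr rfl fun c _ => Finset.sum_congr rfl fun d _ => by ring

lemma quarticForm_add₃ (x y z z' w : α → ℝ) :
    quarticForm K x y (z + z') w = quarticForm K x y z w + quarticForm K x y z' w := by
  simp only [quarticForm, ← Finset.sum_add_distrib, Pi.add_apply]
  refine Finset.sum_congr rfl fun a _ => Finset.sum_congr rfl fun b _ =>
    Finset.sum_congr rfl fun c _ => Finset.sum_congr rfl fun d _ => by ring

lemma quarticForm_add₄ (x y z w w' : α → ℝ) :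
    quarticForm K x y z (w + w') = quarticForm K x y z w + quarticForm K x y z w' := by
  simp only [quarticForm, ← Finset.sum_add_distrib, Pi.add_apply]
  refine Finset.sum_congr rfl fun a _ => Finset.sum_congr rfl fun b _ =>
    Finset.sum_congr rfl fun c _ => Finset.sum_congr rfl fun d _ => by ring

lemma quarticForm_smul (s t u v : ℝ) (x y z w : α → ℝ) :
    quarticForm K (s • x) (t • y) (u • z) (v • w) = s * t * u * v * quarticForm K x y z w := by
  simp only [quarticForm, Finset.mul_sum, Pi.smul_apply, smul_eq_mul]
  refine Finset.sum_congr rfl fun a _ => Finset.sum_congr rfl fun b _ =>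
    Finset.sum_congr rfl fun c _ => Finset.sum_congr rfl fun d _ => by ring

variable {K} {κ : ℝ}

lemma abs_quarticForm_le (hK : ∀ a b c d, |K a b c d| ≤ κ) (x y z w : α → ℝ) :
    |quarticForm K x y z w| ≤ κ * (l1Norm x * l1Norm y * l1Norm z * l1Norm w) := by
  have h : κ * (l1Norm x * l1Norm y * l1Norm z * l1Norm w) =
      ∑ a, ∑ b, ∑ c, ∑ d, κ * (|x a| * |y b| * |z c| * |w d|) := by
    simp only [l1Norm, ← Finset.mul_sum, ← Finset.sum_mul]
  rw [h]
  refine (Finset.abs_sum_le_sum_abs _ _).trans (Finset.sum_le_sum fun a _ => ?_)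
  refine (Finset.abs_sum_le_sum_abs _ _).trans (Finset.sum_le_sum fun b _ => ?_)
  refine (Finset.abs_sum_le_sum_abs _ _).trans (Finset.sum_le_sum fun c _ => ?_)
  refine (Finset.abs_sum_le_sum_abs _ _).trans (Finset.sum_le_sum fun d _ => ?_)
  rw [abs_mul, abs_mul, abs_mul, abs_mul]
  exact mul_le_mul_of_nonneg_right (hK a b c d) (by positivity)

lemma abs_quarticForm_le_of_le (hκ : 0 ≤ κ) (hK : ∀ a b c d, |K a b c d| ≤ κ) {x y z w : α → ℝ}
    {p q r s : ℝ} (hx : l1Norm x ≤ p) (hy : l1Norm y ≤ q) (hz : l1Norm z ≤ r) (hw : l1Norm w ≤ s) :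
    |quarticForm K x y z w| ≤ κ * (p * q * r * s) := by
  refine (abs_quarticForm_le hK x y z w).trans (mul_le_mul_of_nonneg_left ?_ hκ)
  have hp := (l1Norm_nonneg x).trans hx
  have hq := (l1Norm_nonneg y).trans hy
  have hr := (l1Norm_nonneg z).trans hz
  have := l1Norm_nonneg x
  have := l1Norm_nonneg y
  have := l1Norm_nonneg z
  have := l1Norm_nonneg w
  gcongr

/-- A quartic form is Lipschitz on the unit ball of `ℓ¹`. -/
lemma quarticForm_diag_sub_le (hκ : 0 ≤ κ) (hK : ∀ a b c d, |K a b c d| ≤ κ) {x y : α → ℝ}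
    (hx : l1Norm x ≤ 1) (hy : l1Norm y ≤ 1) :
    quarticForm K x x x x ≤ quarticForm K y y y y + 4 * κ * l1Norm (x - y) := by
  have e : quarticForm K x x x x = quarticForm K y y y y + quarticForm K (x - y) x x x +
      quarticForm K y (x - y) x x + quarticForm K y y (x - y) x + quarticForm K y y y (x - y) := by
    have h1 := quarticForm_add₁ K y (x - y) x x x
    have h2 := quarticForm_add₂ K y y (x - y) x x
    have h3 := quarticForm_add₃ K y y y (x - y) x
    have h4 := quarticForm_add₄ K y y y y (x - y)
    rw [add_sub_cancel] at h1 h2 h3 h4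
    linarith
  have b1 := (abs_le.1 (abs_quarticForm_le_of_le hκ hK (le_refl (l1Norm (x - y))) hx hx hx)).2
  have b2 := (abs_le.1 (abs_quarticForm_le_of_le hκ hK hy (le_refl (l1Norm (x - y))) hx hx)).2
  have b3 := (abs_le.1 (abs_quarticForm_le_of_le hκ hK hy hy (le_refl (l1Norm (x - y))) hx)).2
  have b4 := (abs_le.1 (abs_quarticForm_le_of_le hκ hK hy hy hy (le_refl (l1Norm (x - y))))).2
  rw [e]
  linarith

/-- Along a segment, one of the endpoints has a value that exceeds a given intermediate value by at
most a second-order term. -/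
lemma quarticForm_diag_endpoint_le (hκ : 0 ≤ κ) (hK : ∀ a b c d, |K a b c d| ≤ κ) {x h : α → ℝ}
    (hx : l1Norm x ≤ 1) (hxh : l1Norm (x + h) ≤ 1) {p : ℝ} (hp : p ∈ Set.Icc (0 : ℝ) 1) :
    ∃ t : ℝ, (t = 0 ∨ t = 1) ∧
      quarticForm K (x + t • h) (x + t • h) (x + t • h) (x + t • h) ≤
        quarticForm K (x + p • h) (x + p • h) (x + p • h) (x + p • h) +
          18 * κ * l1Norm h ^ 2 := by
  obtain ⟨hp0, hp1⟩ := hp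
  have hh : l1Norm h ≤ 2 := by
    have := l1Norm_sub_le (x + h) x
    rw [add_sub_cancel_left] at this
    linarith
  have hn := l1Norm_nonneg h
  let c2 := quarticForm K h h x x + quarticForm K h x h x + quarticForm K h x x h +
    quarticForm K x h h x + quarticForm K x h x h + quarticForm K x x h h
  let c3 := quarticForm K h h h x + quarticForm K h h x h + quarticForm K h x h h +
    quarticForm K x h h h
  let c4 := quarticForm K h h h h
  let c1 := quarticForm K h x x x + quarticForm K x h x x + quarticForm K x x h x +
    quarticForm K x x x h
  have ex : ∀ t : ℝ, quarticForm K (x + t • h) (x + t • h) (x + t • h) (x + t • h) =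
      quarticForm K x x x x + c1 * t + c2 * t ^ 2 + c3 * t ^ 3 + c4 * t ^ 4 := by
    intro t
    have hs := fun (s₁ s₂ s₃ s₄ : ℝ) (y₁ y₂ y₃ y₄ : α → ℝ) =>
      quarticForm_smul K s₁ s₂ s₃ s₄ y₁ y₂ y₃ y₄
    rw [show x + t • h = (1 : ℝ) • x + t • h by rw [one_smul]]
    simp only [quarticForm_add₁, quarticForm_add₂, quarticForm_add₃, quarticForm_add₄, hs]
    ring
  have bd : ∀ {y₁ y₂ y₃ y₄ : α → ℝ} {q₁ q₂ q₃ q₄ : ℝ}, l1Norm y₁ ≤ q₁ → l1Norm y₂ ≤ q₂ →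
      l1Norm y₃ ≤ q₃ → l1Norm y₄ ≤ q₄ → |quarticForm K y₁ y₂ y₃ y₄| ≤ κ * (q₁ * q₂ * q₃ * q₄) :=
    fun h₁ h₂ h₃ h₄ => abs_quarticForm_le_of_le hκ hK h₁ h₂ h₃ h₄
  have hl := le_refl (l1Norm h)
  have b2 : |c2| ≤ 6 * κ * l1Norm h ^ 2 := by
    have := abs_le.1 (bd hl hl hx hx); have := abs_le.1 (bd hl hx hl hx)
    have := abs_le.1 (bd hl hx hx hl); have := abs_le.1 (bd hx hl hl hx)
    have := abs_le.1 (bd hx hl hx hl); have := abs_le.1 (bd hx hx hl hl)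
    rw [abs_le]; constructor <;> simp only [c2] <;> linarith
  have b3 : |c3| ≤ 8 * κ * l1Norm h ^ 2 := by
    have := abs_le.1 (bd hl hl hh hx); have := abs_le.1 (bd hl hl hx hh)
    have := abs_le.1 (bd hl hx hl hh); have := abs_le.1 (bd hx hl hl hh)
    rw [abs_le]; constructor <;> simp only [c3] <;> linarith
  have b4 : |c4| ≤ 4 * κ * l1Norm h ^ 2 := by
    have := abs_le.1 (bd hl hl hh hh)
    rw [abs_le]; constructor <;> simp only [c4] <;> linarith
  have m2 : c2 * (p - p ^ 2) ≤ 6 * κ * l1Norm h ^ 2 := by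
    have h0 : 0 ≤ p - p ^ 2 := by nlinarith
    have h1 : p - p ^ 2 ≤ 1 := by nlinarith
    calc c2 * (p - p ^ 2) ≤ |c2| * (p - p ^ 2) := mul_le_mul_of_nonneg_right (le_abs_self _) h0
      _ ≤ |c2| * 1 := mul_le_mul_of_nonneg_left h1 (abs_nonneg _)
      _ ≤ _ := by linarith
  have m3 : c3 * (p - p ^ 3) ≤ 8 * κ * l1Norm h ^ 2 := by
    have h0 : 0 ≤ p - p ^ 3 := by
      have := pow_le_of_le_one hp0 hp1 (n := 3) (by norm_num); linarith
    have h1 : p - p ^ 3 ≤ 1 := by have := pow_nonneg hp0 3; linarith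
    calc c3 * (p - p ^ 3) ≤ |c3| * (p - p ^ 3) := mul_le_mul_of_nonneg_right (le_abs_self _) h0
      _ ≤ |c3| * 1 := mul_le_mul_of_nonneg_left h1 (abs_nonneg _)
      _ ≤ _ := by linarith
  have m4 : c4 * (p - p ^ 4) ≤ 4 * κ * l1Norm h ^ 2 := by
    have h0 : 0 ≤ p - p ^ 4 := by
      have := pow_le_of_le_one hp0 hp1 (n := 4) (by norm_num); linarith
    have h1 : p - p ^ 4 ≤ 1 := by have := pow_nonneg hp0 4; linarith
    calc c4 * (p - p ^ 4) ≤ |c4| * (p - p ^ 4) := mul_le_mul_of_nonneg_right (le_abs_self _) h0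
      _ ≤ |c4| * 1 := mul_le_mul_of_nonneg_left h1 (abs_nonneg _)
      _ ≤ _ := by linarith
  by_contra! hcon
  have g0 := hcon 0 (Or.inl rfl)
  have g1 := hcon 1 (Or.inr rfl)
  rw [ex p, ex] at g0 g1
  rcases hp1.lt_or_eq with hlt | rfl
  · have := mul_lt_mul_of_pos_left g0 (sub_pos.2 hlt)
    have := mul_le_mul_of_nonneg_left g1.le hp0
    nlinarith
  · have : 0 ≤ κ * l1Norm h ^ 2 := by positivity
    linarith

/-- Rounding fractional coefficients of a combination to `0` or `1`, one after the other. -/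
lemma exists_rounding_quarticForm_diag_le (hκ : 0 ≤ κ) (hK : ∀ a b c d, |K a b c d| ≤ κ)
    {ι : Type*} [Fintype ι] [DecidableEq ι] (z : α → ℝ) (D : ι → α → ℝ)
    (hmass : ∀ y : ι → ℝ, (∀ k, y k ∈ Set.Icc (0 : ℝ) 1) → l1Norm (z + ∑ k, y k • D k) ≤ 1)
    {p : ℝ} (hp : p ∈ Set.Icc (0 : ℝ) 1) :
    ∃ y : ι → ℝ, (∀ k, y k = 0 ∨ y k = 1) ∧
      quarticForm K (z + ∑ k, y k • D k) (z + ∑ k, y k • D k) (z + ∑ k, y k • D k)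
          (z + ∑ k, y k • D k) ≤
        quarticForm K (z + ∑ k, p • D k) (z + ∑ k, p • D k) (z + ∑ k, p • D k)
          (z + ∑ k, p • D k) + 18 * κ * ∑ k, l1Norm (D k) ^ 2 := by
  have key : ∀ s : Finset ι, ∃ y : ι → ℝ, (∀ k, y k ∈ Set.Icc (0 : ℝ) 1) ∧
      (∀ k ∈ s, y k = 0 ∨ y k = 1) ∧ (∀ k ∉ s, y k = p) ∧
      quarticForm K (z + ∑ k, y k • D k) (z + ∑ k, y k • D k) (z + ∑ k, y k • D k)
          (z + ∑ k, y k • D k) ≤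
        quarticForm K (z + ∑ k, p • D k) (z + ∑ k, p • D k) (z + ∑ k, p • D k)
          (z + ∑ k, p • D k) + 18 * κ * ∑ k ∈ s, l1Norm (D k) ^ 2 := by
    intro s
    induction s using Finset.induction_on with
    | empty => exact ⟨fun _ => p, fun _ => hp, by simp, by simp, by simp⟩
    | insert k s hk ih =>
      obtain ⟨y, hy, hys, hyp, hle⟩ := ih
      have hsplit : ∀ t : ℝ, z + ∑ j, Function.update y k t j • D j =
          (z + ∑ j ∈ Finset.univ.erase k, y j • D j) + t • D k := by
        intro t
        rw [← Finset.add_sum_erase _ _ (Finset.mem_univ k), Function.update_self, add_assoc,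
          add_comm (t • D k)]
        congr 2
        exact Finset.sum_congr rfl fun j hj => by
          rw [Function.update_of_ne (Finset.ne_of_mem_erase hj)]
      have hupd : ∀ t ∈ Set.Icc (0 : ℝ) 1, ∀ j, Function.update y k t j ∈ Set.Icc (0 : ℝ) 1 := by
        intro t ht j
        rcases eq_or_ne j k with rfl | h
        · rwa [Function.update_self]
        · rw [Function.update_of_ne h]; exact hy j
      have h0 := hmass _ (hupd 0 (by simp))
      have h1 := hmass _ (hupd 1 (by simp))
      rw [hsplit, zero_smul, add_zero] at h0
      rw [hsplit, one_smul] at h1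
      obtain ⟨t, ht, hle'⟩ := quarticForm_diag_endpoint_le hκ hK h0 h1 hp
      have hyk : Function.update y k p = y := by
        rw [← hyp k hk, Function.update_eq_self]
      rw [← hsplit, ← hsplit, hyk] at hle'
      refine ⟨Function.update y k t, hupd t ?_, ?_, ?_, ?_⟩
      · rcases ht with rfl | rfl <;> simp
      · intro j hj
        rcases eq_or_ne j k with rfl | h
        · rwa [Function.update_self]
        · rw [Function.update_of_ne h]
          exact hys j (Finset.mem_of_mem_insert_of_ne hj h)
      · intro j hj
        rw [Finset.mem_insert, not_or] at hj
        rw [Function.update_of_ne hj.1]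
        exact hyp j hj.2
      · rw [Finset.sum_insert hk]
        linarith
  obtain ⟨y, -, hy, -, hle⟩ := key Finset.univ
  exact ⟨y, fun k => hy k (Finset.mem_univ k), hle⟩

end QuarticForm

section Arcs

/-- The cycles of a permutation can be cut into arcs of length at most `L`, with few cuts. -/
lemma Equiv.Perm.exists_arcs {V : Type*} [Fintype V] [DecidableEq V] (τ : Equiv.Perm V) {L : ℕ}
    (hL : 0 < L) :
    ∃ (b : V → V) (E : Finset V), (∀ i ∉ E, b (τ i) = b i) ∧
      (∀ k, (Finset.univ.filter fun i => b i = k).card ≤ L) ∧ E.card * L ≤ 2 * Fintype.card V := by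
  classical
  let base : V → V := fun i => (Quotient.mk (Equiv.Perm.SameCycle.setoid τ) i).out
  have base_same : ∀ i, τ.SameCycle (base i) i := fun i =>
    Quotient.mk_out (s := Equiv.Perm.SameCycle.setoid τ) i
  have base_eq : ∀ {i j}, τ.SameCycle i j → base i = base j := fun {i j} h =>
    congrArg Quotient.out (Quotient.sound (s := Equiv.Perm.SameCycle.setoid τ) h)
  have ex : ∀ i, ∃ k : ℕ, (τ ^ k) (base i) = i := fun i => (base_same i).exists_nat_pow_eq
  let l : V → ℕ := fun i => Nat.find (ex i)
  have hl : ∀ i, (τ ^ l i) (base i) = i := fun i => Nat.find_spec (ex i)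
  have hmin : ∀ {i k}, (τ ^ k) (base i) = i → l i ≤ k := fun {i k} h => Nat.find_min' (ex i) h
  have base_pow : ∀ i k, base ((τ ^ k) (base i)) = base i := by
    intro i k
    refine base_eq (Equiv.Perm.SameCycle.trans ?_ (base_same i))
    exact (Equiv.Perm.sameCycle_pow_left).2 (Equiv.Perm.SameCycle.refl _ _)
  have l_pow : ∀ i k, k ≤ l i → l ((τ ^ k) (base i)) = k := by
    intro i k hk
    apply le_antisymm
    · apply hmin
      rw [base_pow]
    · by_contra! h
      have h1 := hl ((τ ^ k) (base i))
      rw [base_pow] at h1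
      have h2 : (τ ^ (l i - k + l ((τ ^ k) (base i)))) (base i) = i := by
        rw [pow_add, Equiv.Perm.mul_apply, h1, ← Equiv.Perm.mul_apply, ← pow_add,
          Nat.sub_add_cancel hk, hl]
      have := hmin h2
      omega
  have base_apply : ∀ i, base (τ i) = base i := fun i =>
    base_eq ((Equiv.Perm.sameCycle_apply_left).2 (Equiv.Perm.SameCycle.refl _ _))
  have inj : ∀ {i j}, base i = base j → l i = l j → i = j := by
    intro i j h1 h2
    rw [← hl i, ← hl j, h1, h2]
  let c : V → V × ℕ := fun i => (base i, l i / L)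
  let E₁ : Finset V := Finset.univ.filter fun i => L ∣ l i + 1
  let E₂ : Finset V := Finset.univ.filter fun i => τ i = base i ∧ L ≤ l i
  have hne : ∀ i : V, Nonempty V := fun i => ⟨i⟩
  let b : V → V := fun i => have := hne i; Function.invFun c (c i)
  have hb : ∀ {i j}, c i = c j → b i = b j := by
    intro i j h
    simp only [b, h]
  have hb' : ∀ {i j}, b i = b j → c i = c j := by
    intro i j h
    have := hne i
    have h1 : c (Function.invFun c (c i)) = c i := Function.invFun_eq ⟨i, rfl⟩
    have h2 : c (Function.invFun c (c j)) = c j := Function.invFun_eq ⟨j, rfl⟩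
    rw [← h1, ← h2]
    exact congrArg c h
  refine ⟨b, E₁ ∪ E₂, ?_, ?_, ?_⟩
  · intro i hi
    simp only [E₁, E₂, Finset.mem_union, Finset.mem_filter, Finset.mem_univ, true_and, not_or,
      not_and, not_le] at hi
    obtain ⟨h1, h2⟩ := hi
    apply hb
    simp only [c, base_apply, Prod.mk.injEq, true_and]
    by_cases h : τ i = base i
    · have : l (τ i) = 0 := by
        apply Nat.le_zero.1
        apply hmin
        rw [base_apply, h]; rfl
      rw [this, Nat.div_eq_of_lt (h2 h), Nat.zero_div]
    · have h3 : l (τ i) = l i + 1 := by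
        apply le_antisymm
        · apply hmin
          rw [base_apply, pow_succ', Equiv.Perm.mul_apply, hl]
        · have h4 := hl (τ i)
          rw [base_apply] at h4
          rcases Nat.eq_zero_or_pos (l (τ i)) with h5 | h5
          · rw [h5] at h4
            exact absurd h4.symm h
          · obtain ⟨k, hk⟩ := Nat.exists_eq_succ_of_ne_zero h5.ne'
            rw [hk, Nat.succ_eq_add_one, pow_succ', Equiv.Perm.mul_apply] at h4
            have := hmin (τ.injective h4)
            omega
      rw [h3, Nat.succ_div, if_neg h1, add_zero]
  · intro k
    rw [← Finset.card_range L]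
    apply Finset.card_le_card_of_injOn (fun i => l i % L)
    · intro i _
      simpa using Nat.mod_lt _ hL
    · intro i hi j hj h
      simp only [Finset.coe_filter, Finset.mem_univ, true_and, Set.mem_ofPred_eq] at hi hj
      have h1 := hb' (hi.trans hj.symm)
      simp only [c, Prod.mk.injEq] at h1
      refine inj h1.1 ?_
      rw [← Nat.div_add_mod (l i) L, ← Nat.div_add_mod (l j) L, h1.2]
      simp only at h
      rw [h]
  · have c1 : E₁.card * L ≤ Fintype.card V := by
      rw [← Finset.card_univ, show E₁.card * L = (E₁ ×ˢ Finset.range L).card by simp]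
      apply Finset.card_le_card_of_injOn (fun q : V × ℕ => (τ ^ (l q.1 - q.2)) (base q.1))
      · intro _ _; simp
      · rintro ⟨i, k⟩ hi ⟨j, k'⟩ hj h
        simp only [E₁, Finset.coe_product, Finset.coe_filter, Finset.mem_univ, true_and,
          Finset.coe_range, Set.mem_prod, Set.mem_ofPred_eq, Set.mem_Iio] at hi hj h
        have h1 := congrArg base h
        rw [base_pow, base_pow] at h1
        have h2 := congrArg l h
        rw [l_pow _ _ (Nat.sub_le _ _), l_pow _ _ (Nat.sub_le _ _)] at h2
        obtain ⟨⟨u, hu⟩, hk⟩ := hi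
        obtain ⟨⟨v, hv⟩, hk'⟩ := hj
        have hu0 : 0 < u := Nat.pos_of_ne_zero (by rintro rfl; simp at hu)
        have hv0 : 0 < v := Nat.pos_of_ne_zero (by rintro rfl; simp at hv)
        have hLu : L * 1 ≤ L * u := Nat.mul_le_mul_left L hu0
        have hLv : L * 1 ≤ L * v := Nat.mul_le_mul_left L hv0
        have huv : u = v := by
          rcases lt_trichotomy u v with h | h | h
          · have : L * (u + 1) ≤ L * v := Nat.mul_le_mul_left L h
            rw [mul_add] at this
            omega
          · exact h
          · have : L * (v + 1) ≤ L * u := Nat.mul_le_mul_left L h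
            rw [mul_add] at this
            omega
        subst huv
        have h3 : l i = l j := by omega
        have h4 : k = k' := by omega
        rw [inj h1 h3, h4]
    have c2 : E₂.card * L ≤ Fintype.card V := by
      rw [← Finset.card_univ, show E₂.card * L = (E₂ ×ˢ Finset.range L).card by simp]
      apply Finset.card_le_card_of_injOn (fun q : V × ℕ => (τ ^ q.2) (base q.1))
      · intro _ _; simp
      · rintro ⟨i, k⟩ hi ⟨j, k'⟩ hj h
        simp only [E₂, Finset.coe_product, Finset.coe_filter, Finset.mem_univ, true_and,
          Finset.coe_range, Set.mem_prod, Set.mem_ofPred_eq, Set.mem_Iio] at hi hj h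
        have h1 := congrArg base h
        rw [base_pow, base_pow] at h1
        have h2 := congrArg l h
        rw [l_pow _ _ (by omega), l_pow _ _ (by omega)] at h2
        rw [h2, τ.injective (hi.1.1.trans (h1.trans hj.1.1.symm))]
    calc (E₁ ∪ E₂).card * L ≤ (E₁.card + E₂.card) * L :=
          Nat.mul_le_mul_right L (Finset.card_union_le _ _)
      _ ≤ 2 * Fintype.card V := by rw [add_mul]; omega

end Arcs

/-- The indicator function of the graph of a permutation. -/
def permIndicator {V : Type*} [DecidableEq V] (σ : Equiv.Perm V) (a : V × V) : ℝ :=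
  if σ a.1 = a.2 then 1 else 0

section PermIndicator

variable {V : Type*} [DecidableEq V]

lemma permIndicator_nonneg (σ : Equiv.Perm V) (a : V × V) : 0 ≤ permIndicator σ a := by
  unfold permIndicator; split_ifs <;> norm_num

lemma sum_permIndicator_mul [Fintype V] (σ : Equiv.Perm V) (F : V × V → ℝ) :
    ∑ a, permIndicator σ a * F a = ∑ i, F (i, σ i) := by
  simp [permIndicator, Fintype.sum_prod_type]

lemma quarticForm_permIndicator [Fintype V] (K : V × V → V × V → V × V → V × V → ℝ)
    (σ : Equiv.Perm V) (c : ℝ) :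
    quarticForm K (c • permIndicator σ) (c • permIndicator σ) (c • permIndicator σ)
        (c • permIndicator σ) =
      c ^ 4 * ∑ i, ∑ j, ∑ k, ∑ l, K (i, σ i) (j, σ j) (k, σ k) (l, σ l) := by
  have h : quarticForm K (permIndicator σ) (permIndicator σ) (permIndicator σ) (permIndicator σ) =
      ∑ a, permIndicator σ a * ∑ b, permIndicator σ b * ∑ c, permIndicator σ c *
        ∑ d, permIndicator σ d * K a b c d := by
    simp only [quarticForm, Finset.mul_sum]
    refine Finset.sum_congr rfl fun a _ => Finset.sum_congr rfl fun b _ =>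
      Finset.sum_congr rfl fun c _ => Finset.sum_congr rfl fun d _ => by ring
  rw [quarticForm_smul, h]
  simp only [sum_permIndicator_mul]
  ring

end PermIndicator

section CutNorm

lemma abs_sum_mul_le_of_forall_abs_sum_le {α : Type*} [Fintype α] {h f : α → ℝ} {ε M : ℝ}
    (hh : ∀ S : Finset α, |∑ a ∈ S, h a| ≤ ε) (hf : ∀ a, |f a| ≤ M) (hM : 0 ≤ M) :
    |∑ a, f a * h a| ≤ 2 * M * ε := by
  have h1 : ∑ a, |h a| ≤ 2 * ε := by
    rw [← Finset.sum_filter_add_sum_filter_not Finset.univ (fun a => 0 ≤ h a)]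
    have e1 : ∑ a with 0 ≤ h a, |h a| = ∑ a with 0 ≤ h a, h a :=
      Finset.sum_congr rfl fun a ha => abs_of_nonneg (Finset.mem_filter.1 ha).2
    have e2 : ∑ a with ¬ 0 ≤ h a, |h a| = -∑ a with ¬ 0 ≤ h a, h a := by
      rw [← Finset.sum_neg_distrib]
      exact Finset.sum_congr rfl fun a ha =>
        abs_of_neg (not_le.1 (Finset.mem_filter.1 ha).2)
    rw [e1, e2]
    have := (abs_le.1 (hh (Finset.univ.filter fun a => 0 ≤ h a))).2
    have := (abs_le.1 (hh (Finset.univ.filter fun a => ¬ 0 ≤ h a))).1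
    linarith
  calc |∑ a, f a * h a| ≤ ∑ a, |f a * h a| := Finset.abs_sum_le_sum_abs _ _
    _ ≤ ∑ a, M * |h a| := Finset.sum_le_sum fun a _ => by
        rw [abs_mul]; exact mul_le_mul_of_nonneg_right (hf a) (abs_nonneg _)
    _ = M * ∑ a, |h a| := by rw [Finset.mul_sum]
    _ ≤ M * (2 * ε) := mul_le_mul_of_nonneg_left h1 hM
    _ = 2 * M * ε := by ring

/-- The cut norm controls the bilinear form on bounded functions. -/
lemma abs_bilin_le_of_cut_le {α : Type*} [Fintype α] {w : α → α → ℝ} {ε M N : ℝ}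
    (hw : ∀ S T : Finset α, |∑ a ∈ S, ∑ b ∈ T, w a b| ≤ ε) {f g : α → ℝ}
    (hf : ∀ a, |f a| ≤ M) (hg : ∀ a, |g a| ≤ N) (hM : 0 ≤ M) (hN : 0 ≤ N) :
    |∑ a, ∑ b, f a * g b * w a b| ≤ 4 * M * N * ε := by
  have h1 : ∀ T : Finset α, |∑ b ∈ T, ∑ a, f a * w a b| ≤ 2 * M * ε := by
    intro T
    have := abs_sum_mul_le_of_forall_abs_sum_le (h := fun a => ∑ b ∈ T, w a b)
      (fun S => hw S T) hf hM
    simp only [Finset.mul_sum] at this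
    rwa [Finset.sum_comm] at this
  have h2 := abs_sum_mul_le_of_forall_abs_sum_le h1 hg hN
  have e : ∑ a, ∑ b, f a * g b * w a b = ∑ b, g b * ∑ a, f a * w a b := by
    rw [Finset.sum_comm]
    simp only [Finset.mul_sum]
    refine Finset.sum_congr rfl fun a _ => Finset.sum_congr rfl fun b _ => by ring
  rw [e]
  linarith

/-- The kernel of the homomorphism density of the four-cycle. -/
def fourCycleKernel {α : Type*} (W : α → α → ℝ) (a b c d : α) : ℝ :=
  W a b * W c b * W a d * W c d

lemma abs_fourCycleKernel_le {α : Type*} {W : α → α → ℝ} {M : ℝ} (hW : ∀ a b, |W a b| ≤ M)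
    (a b c d : α) : |fourCycleKernel W a b c d| ≤ M ^ 4 := by
  have hM := (abs_nonneg _).trans (hW a b)
  rw [fourCycleKernel, abs_mul, abs_mul, abs_mul]
  calc _ ≤ M * M * M * M := by
        gcongr
        exacts [hW _ _, hW _ _, hW _ _, hW _ _]
    _ = _ := by ring

/-- The density of the four-cycle is bounded by the cut norm. -/
lemma quarticForm_fourCycleKernel_le {α : Type*} [Fintype α] {W : α → α → ℝ} {M ε : ℝ}
    (hM : 0 ≤ M) (hW : ∀ a b, |W a b| ≤ M) {x : α → ℝ} (hx : ∀ a, 0 ≤ x a) (hx1 : ∑ a, x a = 1)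
    (hε : ∀ S T : Finset α, |∑ a ∈ S, ∑ b ∈ T, x a * x b * W a b| ≤ ε) :
    quarticForm (fourCycleKernel W) x x x x ≤ 4 * M ^ 3 * ε := by
  have e : quarticForm (fourCycleKernel W) x x x x = ∑ a, ∑ b, x a * x b *
      (W a b * ∑ c, ∑ d, W c b * W a d * (x c * x d * W c d)) := by
    simp only [quarticForm, fourCycleKernel, Finset.mul_sum]
    refine Finset.sum_congr rfl fun a _ => Finset.sum_congr rfl fun b _ =>
      Finset.sum_congr rfl fun c _ => Finset.sum_congr rfl fun d _ => by ring
  rw [e]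
  have h1 : ∑ a, ∑ b, x a * x b * (4 * M ^ 3 * ε) = 4 * M ^ 3 * ε := by
    simp only [← Finset.sum_mul, ← Finset.mul_sum, hx1, one_mul]
  rw [← h1]
  refine Finset.sum_le_sum fun a _ => Finset.sum_le_sum fun b _ =>
    mul_le_mul_of_nonneg_left ?_ (mul_nonneg (hx a) (hx b))
  have h2 := abs_bilin_le_of_cut_le hε (f := fun c => W c b) (g := fun d => W a d)
    (fun c => hW c b) (fun d => hW a d) hM hM
  refine (le_abs_self _).trans ?_
  rw [abs_mul]
  refine (mul_le_mul (hW a b) h2 (abs_nonneg _) hM).trans (le_of_eq ?_)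
  ring

/-- The cut norm of a matrix is bounded in terms of the density of the four-cycle. -/
lemma cut_pow_four_le {V : Type*} [Fintype V] (D : V → V → ℝ) (S T : Finset V) :
    (∑ i ∈ S, ∑ j ∈ T, D i j) ^ 4 ≤
      (Fintype.card V : ℝ) ^ 4 * ∑ i, ∑ j, ∑ k, ∑ l, fourCycleKernel D i j k l := by
  set n : ℝ := (Fintype.card V : ℝ)
  have hn : 0 ≤ n := Nat.cast_nonneg _
  have hc : ∀ U : Finset V, (U.card : ℝ) ≤ n := fun U => Nat.cast_le.2 (Finset.card_le_univ U)
  let g : ℝ := ∑ j, (∑ i ∈ S, D i j) ^ 2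
  have h1 : (∑ i ∈ S, ∑ j ∈ T, D i j) ^ 2 ≤ n * g := by
    rw [Finset.sum_comm]
    refine sq_sum_le_card_mul_sum_sq.trans ?_
    have h0 : ∑ j ∈ T, (∑ i ∈ S, D i j) ^ 2 ≤ g :=
      Finset.sum_le_sum_of_subset_of_nonneg (Finset.subset_univ T) fun _ _ _ => sq_nonneg _
    exact mul_le_mul (hc T) h0 (Finset.sum_nonneg fun _ _ => sq_nonneg _) hn
  have h2 : g = ∑ q ∈ S ×ˢ S, ∑ j, D q.1 j * D q.2 j := by
    simp only [g, pow_two, Finset.sum_mul_sum]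
    rw [Finset.sum_product, Finset.sum_comm]
    refine Finset.sum_congr rfl fun i _ => ?_
    rw [Finset.sum_comm]
  have h3 : g ^ 2 ≤ n ^ 2 * ∑ i, ∑ j, ∑ k, ∑ l, fourCycleKernel D i j k l := by
    rw [h2]
    refine sq_sum_le_card_mul_sum_sq.trans ?_
    refine mul_le_mul ?_ ?_ (Finset.sum_nonneg fun _ _ => sq_nonneg _) (sq_nonneg n)
    · rw [Finset.card_product, Nat.cast_mul, pow_two]
      exact mul_le_mul (hc S) (hc S) (Nat.cast_nonneg _) hn
    · refine (Finset.sum_le_sum_of_subset_of_nonneg (Finset.subset_univ (S ×ˢ S))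
        fun _ _ _ => sq_nonneg _).trans (le_of_eq ?_)
      rw [Fintype.sum_prod_type]
      refine Finset.sum_congr rfl fun i _ => ?_
      simp only [pow_two, Finset.sum_mul_sum, fourCycleKernel]
      rw [Finset.sum_comm]
      refine (Finset.sum_congr rfl fun j _ => ?_)
      refine Finset.sum_congr rfl fun k _ => Finset.sum_congr rfl fun l _ => by ring
  calc (∑ i ∈ S, ∑ j ∈ T, D i j) ^ 4 = ((∑ i ∈ S, ∑ j ∈ T, D i j) ^ 2) ^ 2 := by ring
    _ ≤ (n * g) ^ 2 := by gcongr
    _ = n ^ 2 * g ^ 2 := by ring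
    _ ≤ n ^ 2 * _ := mul_le_mul_of_nonneg_left h3 (sq_nonneg n)
    _ = _ := by ring

end CutNorm

section Merge

universe u

variable {V : Type u} [Fintype V] [DecidableEq V]

lemma l1Norm_permIndicator_mul (σ : Equiv.Perm V) (f : V → ℝ) :
    l1Norm (fun a : V × V => permIndicator σ a * f a.1) = ∑ i, |f i| := by
  simp only [l1Norm, abs_mul, abs_of_nonneg (permIndicator_nonneg σ _)]
  exact sum_permIndicator_mul σ fun a => |f a.1|

/-- Two permutations in a combination can be merged into one, almost without increasing a quartic
form. -/
lemma exists_merge_quarticForm_le [Nonempty V] {κ : ℝ} {K : V × V → V × V → V × V → V × V → ℝ}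
    (hκ : 0 ≤ κ) (hK : ∀ a b c d, |K a b c d| ≤ κ) {Z : V × V → ℝ} (hZ : ∀ a, 0 ≤ Z a)
    (σ₁ σ₂ : Equiv.Perm V) {l₁ l₂ : ℝ} (h₁ : 0 ≤ l₁) (h₂ : 0 ≤ l₂)
    (hmass : ∑ a, Z a + (l₁ + l₂) * Fintype.card V ≤ 1) {L : ℕ} (hL : 0 < L) :
    ∃ σ : Equiv.Perm V,
      quarticForm K (Z + (l₁ + l₂) • permIndicator σ) (Z + (l₁ + l₂) • permIndicator σ)
          (Z + (l₁ + l₂) • permIndicator σ) (Z + (l₁ + l₂) • permIndicator σ) ≤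
        quarticForm K (Z + (l₁ • permIndicator σ₁ + l₂ • permIndicator σ₂))
          (Z + (l₁ • permIndicator σ₁ + l₂ • permIndicator σ₂))
          (Z + (l₁ • permIndicator σ₁ + l₂ • permIndicator σ₂))
          (Z + (l₁ • permIndicator σ₁ + l₂ • permIndicator σ₂)) +
        (l₁ + l₂) * Fintype.card V * (κ * (16 / L + 72 * L / Fintype.card V)) := by
  set n : ℝ := (Fintype.card V : ℝ)
  have hn : 0 < n := Nat.cast_pos.2 Fintype.card_pos
  have hLr : (0 : ℝ) < L := Nat.cast_pos.2 hL
  rcases (add_nonneg h₁ h₂).eq_or_lt with hm | hm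
  · have e1 : l₁ = 0 := by linarith
    have e2 : l₂ = 0 := by linarith
    exact ⟨σ₁, by simp [e1, e2]⟩
  set m := l₁ + l₂ with hmdef
  let p := l₁ / m
  have hmp : m * p = l₁ := mul_div_cancel₀ _ hm.ne'
  have hmp' : m * (1 - p) = l₂ := by rw [mul_sub, hmp]; linarith
  have hp : p ∈ Set.Icc (0 : ℝ) 1 := ⟨by positivity, by
    rw [div_le_one hm]; linarith⟩
  obtain ⟨b, E, hb, hfib, hE⟩ := Equiv.Perm.exists_arcs (σ₁⁻¹ * σ₂) hL
  have hb : ∀ i ∉ E, b (σ₁⁻¹ (σ₂ i)) = b i := hb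
  have hE' : (E.card : ℝ) ≤ 2 * n / L := by
    rw [le_div_iff₀ hLr]
    have h : ((E.card * L : ℕ) : ℝ) ≤ ((2 * Fintype.card V : ℕ) : ℝ) := Nat.cast_le.2 hE
    push_cast at h
    exact h
  let Z₀ : V × V → ℝ := fun a => Z a + if a.1 ∈ E then 0 else m * permIndicator σ₂ a
  let D : V → V × V → ℝ := fun k a =>
    if a.1 ∉ E ∧ b a.1 = k then m * (permIndicator σ₁ a - permIndicator σ₂ a) else 0
  have hform : ∀ (y : V → ℝ) a, (Z₀ + ∑ k, y k • D k) a = Z a + if a.1 ∈ E then 0 else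
      m * (permIndicator σ₁ a * y (b a.1) + permIndicator σ₂ a * (1 - y (b a.1))) := by
    intro y a
    simp only [Pi.add_apply, Finset.sum_apply, Pi.smul_apply, smul_eq_mul, Z₀, D]
    by_cases ha : a.1 ∈ E
    · simp [ha]
    · simp only [ha, not_false_iff, true_and, if_false, mul_ite, mul_zero, Finset.sum_ite_eq,
        Finset.mem_univ, if_true]
      ring
  have hform_nonneg : ∀ y : V → ℝ, (∀ k, y k ∈ Set.Icc (0 : ℝ) 1) →
      ∀ a, 0 ≤ (Z₀ + ∑ k, y k • D k) a := by
    intro y hy a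
    rw [hform]
    have hy1 := (hy (b a.1)).1
    have hy2 := sub_nonneg.2 (hy (b a.1)).2
    have := permIndicator_nonneg σ₁ a
    have := permIndicator_nonneg σ₂ a
    refine add_nonneg (hZ a) ?_
    split_ifs
    · exact le_refl 0
    · positivity
  have hD : ∀ y : V → ℝ, (∀ k, y k ∈ Set.Icc (0 : ℝ) 1) →
      l1Norm (Z₀ + ∑ k, y k • D k) ≤ 1 := by
    intro y hy
    rw [l1Norm_eq_sum (hform_nonneg y hy)]
    refine le_trans ?_ hmass
    have e : m * n = ∑ a : V × V, (permIndicator σ₁ a * (m * y (b a.1)) +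
        permIndicator σ₂ a * (m * (1 - y (b a.1)))) := by
      rw [Finset.sum_add_distrib, sum_permIndicator_mul σ₁ fun a => m * y (b a.1),
        sum_permIndicator_mul σ₂ fun a => m * (1 - y (b a.1)), ← Finset.sum_add_distrib]
      simp only [← mul_add, add_sub_cancel]
      simp [n, mul_comm]
    rw [e, ← Finset.sum_add_distrib]
    refine Finset.sum_le_sum fun a _ => ?_
    rw [hform]
    have hy1 := (hy (b a.1)).1
    have hy2 := sub_nonneg.2 (hy (b a.1)).2
    have := permIndicator_nonneg σ₁ a
    have := permIndicator_nonneg σ₂ a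
    split_ifs
    · have : 0 ≤ permIndicator σ₁ a * (m * y (b a.1)) +
        permIndicator σ₂ a * (m * (1 - y (b a.1))) := by positivity
      linarith
    · linarith
  obtain ⟨y, hy, hle⟩ := exists_rounding_quarticForm_diag_le hκ hK Z₀ D hD hp
  have hy01 : ∀ k, y k ∈ Set.Icc (0 : ℝ) 1 := fun k => by
    rcases hy k with h | h <;> rw [h] <;> simp
  have hDk : ∀ k, l1Norm (D k) ≤ 2 * m * (Finset.univ.filter fun i => b i = k).card := by
    intro k
    have h0 : ∀ σ : Equiv.Perm V,
        l1Norm (fun a : V × V => permIndicator σ a * (if b a.1 = k then m else 0)) =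
          m * (Finset.univ.filter fun i => b i = k).card := by
      intro σ
      rw [l1Norm_permIndicator_mul σ fun i => if b i = k then m else 0]
      simp only [apply_ite abs, abs_zero, abs_of_pos hm]
      rw [← Finset.sum_filter]
      simp [mul_comm]
    have h1 : l1Norm (D k) ≤ l1Norm ((fun a : V × V =>
        permIndicator σ₁ a * (if b a.1 = k then m else 0)) - fun a : V × V =>
        permIndicator σ₂ a * (if b a.1 = k then m else 0)) := by
      refine Finset.sum_le_sum fun a _ => ?_
      simp only [D, Pi.sub_apply]
      by_cases hbk : b a.1 = k
      · by_cases ha : a.1 ∈ E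
        · simp [ha]
        · simp only [ha, hbk, not_false_iff, and_self, if_true]
          exact le_of_eq (congrArg abs (by ring))
      · simp [hbk]
    have h2 := l1Norm_sub_le (fun a : V × V =>
        permIndicator σ₁ a * (if b a.1 = k then m else 0)) fun a : V × V =>
        permIndicator σ₂ a * (if b a.1 = k then m else 0)
    rw [h0, h0] at h2
    linarith
  have hDsum : ∑ k, l1Norm (D k) ^ 2 ≤ 4 * m ^ 2 * L * n := by
    have h0 : ∑ k, ((Finset.univ.filter fun i => b i = k).card : ℝ) = n := by
      have := Finset.card_eq_sum_card_fiberwise (f := b) (s := Finset.univ) (t := Finset.univ)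
        (fun _ _ => Finset.mem_coe.2 (Finset.mem_univ _))
      rw [Finset.card_univ] at this
      rw [← Nat.cast_sum, ← this]
    rw [← h0, Finset.mul_sum]
    refine Finset.sum_le_sum fun k _ => ?_
    have h3 : ((Finset.univ.filter fun i => b i = k).card : ℝ) ≤ L := by exact_mod_cast hfib k
    have h4 : (0 : ℝ) ≤ (Finset.univ.filter fun i => b i = k).card := Nat.cast_nonneg _
    calc l1Norm (D k) ^ 2 ≤ (2 * m * (Finset.univ.filter fun i => b i = k).card) ^ 2 := by
          gcongr
          · exact l1Norm_nonneg _
          · exact hDk k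
      _ = 4 * m ^ 2 * ((Finset.univ.filter fun i => b i = k).card *
            (Finset.univ.filter fun i => b i = k).card) := by ring
      _ ≤ 4 * m ^ 2 * (L * (Finset.univ.filter fun i => b i = k).card) := by gcongr
      _ = _ := by ring
  obtain ⟨g, hg⟩ := Finset.exists_equiv_extend_of_card_eq (α := V) (β := V) (t := Finset.univ)
    (by rw [Finset.card_univ]) (s := Eᶜ) (f := fun i => if y (b i) = 1 then σ₁ i else σ₂ i)
    (Finset.subset_univ _) (by
      intro i hi j hj hij
      rw [Finset.mem_coe, Finset.mem_compl] at hi hj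
      have hval : ∀ k ∉ E, b (σ₁⁻¹ (if y (b k) = 1 then σ₁ k else σ₂ k)) = b k := by
        intro k hk
        split_ifs
        · rw [← Equiv.Perm.mul_apply, inv_mul_cancel, Equiv.Perm.one_apply]
        · exact hb k hk
      have hbij : b i = b j := by
        rw [← hval i hi, ← hval j hj]
        exact congrArg (fun u => b (σ₁⁻¹ u)) hij
      simp only [hbij] at hij
      split_ifs at hij
      · exact σ₁.injective hij
      · exact σ₂.injective hij)
  let σ : Equiv.Perm V := g.trans (Equiv.subtypeUnivEquiv Finset.mem_univ)
  have hσ : ∀ i ∉ E, σ i = if y (b i) = 1 then σ₁ i else σ₂ i := fun i hi =>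
    hg i (Finset.mem_compl.2 hi)
  have hsumE : ∀ c : ℝ, 0 ≤ c → ∑ i : V, |if i ∈ E then c else 0| = c * E.card := by
    intro c hc
    simp only [apply_ite abs, abs_zero, abs_of_nonneg hc]
    rw [← Finset.sum_filter]
    simp [mul_comm]
  have hmassσ : l1Norm (Z + m • permIndicator σ) ≤ 1 := by
    rw [l1Norm_eq_sum fun a => by
      have := hZ a
      have := permIndicator_nonneg σ a
      simp only [Pi.add_apply, Pi.smul_apply, smul_eq_mul]
      positivity]
    simp only [Pi.add_apply, Pi.smul_apply, smul_eq_mul, Finset.sum_add_distrib]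
    have := sum_permIndicator_mul σ fun _ => m
    simp only [Finset.sum_const, Finset.card_univ, nsmul_eq_mul] at this
    simp only [mul_comm m (permIndicator σ _), this]
    rw [mul_comm]
    exact hmass
  have hmass₁₂ : l1Norm (Z + (l₁ • permIndicator σ₁ + l₂ • permIndicator σ₂)) ≤ 1 := by
    rw [l1Norm_eq_sum fun a => by
      have := hZ a
      have := permIndicator_nonneg σ₁ a
      have := permIndicator_nonneg σ₂ a
      simp only [Pi.add_apply, Pi.smul_apply, smul_eq_mul]
      positivity]
    simp only [Pi.add_apply, Pi.smul_apply, smul_eq_mul, Finset.sum_add_distrib]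
    have e1 := sum_permIndicator_mul σ₁ fun _ => l₁
    have e2 := sum_permIndicator_mul σ₂ fun _ => l₂
    simp only [Finset.sum_const, Finset.card_univ, nsmul_eq_mul] at e1 e2
    simp only [mul_comm l₁ (permIndicator σ₁ _), mul_comm l₂ (permIndicator σ₂ _), e1, e2]
    rw [← mul_add, mul_comm]
    exact hmass
  have hdist₁ : l1Norm (Z + m • permIndicator σ - (Z₀ + ∑ k, y k • D k)) = m * E.card := by
    rw [← hsumE m hm.le, ← l1Norm_permIndicator_mul σ]
    congr 1
    funext a
    rw [Pi.sub_apply, hform]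
    simp only [Pi.add_apply, Pi.smul_apply, smul_eq_mul]
    by_cases ha : a.1 ∈ E
    · simp [ha, mul_comm]
    · simp only [ha, if_false, permIndicator, hσ a.1 ha]
      rcases hy (b a.1) with h | h <;> simp [h]
  have hdist₂ : l1Norm (Z₀ + ∑ k, p • D k -
      (Z + (l₁ • permIndicator σ₁ + l₂ • permIndicator σ₂))) ≤ m * E.card := by
    have h0 : Z₀ + ∑ k, p • D k - (Z + (l₁ • permIndicator σ₁ + l₂ • permIndicator σ₂)) =
        (fun a : V × V => permIndicator σ₁ a * (if a.1 ∈ E then -l₁ else 0)) -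
          fun a : V × V => permIndicator σ₂ a * (if a.1 ∈ E then l₂ else 0) := by
      funext a
      rw [Pi.sub_apply, hform fun _ => p]
      simp only [Pi.add_apply, Pi.sub_apply, Pi.smul_apply, smul_eq_mul]
      by_cases ha : a.1 ∈ E
      · simp only [ha, if_true]; ring
      · simp only [ha, if_false]
        rw [← hmp, ← hmp']; ring
    rw [h0]
    refine (l1Norm_sub_le _ _).trans (le_of_eq ?_)
    rw [l1Norm_permIndicator_mul σ₁ fun i => if i ∈ E then -l₁ else 0,
      l1Norm_permIndicator_mul σ₂ fun i => if i ∈ E then l₂ else 0, hsumE l₂ h₂]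
    have h1 : ∑ i, |if i ∈ E then -l₁ else 0| = ∑ i, |if i ∈ E then l₁ else 0| :=
      Finset.sum_congr rfl fun i _ => by split_ifs <;> simp
    rw [h1, hsumE l₁ h₁, ← add_mul]
  refine ⟨σ, ?_⟩
  have q1 := quarticForm_diag_sub_le hκ hK hmassσ (hD y hy01)
  have q2 := quarticForm_diag_sub_le hκ hK (hD (fun _ => p) fun _ => hp) hmass₁₂
  rw [hdist₁] at q1
  have hmn : m * n ≤ 1 := by
    have := Finset.sum_nonneg fun a (_ : a ∈ Finset.univ) => hZ a
    linarith
  have r1 : 4 * κ * (m * E.card) ≤ 4 * κ * (m * (2 * n / L)) := by gcongr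
  have r2 : 4 * κ * l1Norm (Z₀ + ∑ k, p • D k -
      (Z + (l₁ • permIndicator σ₁ + l₂ • permIndicator σ₂))) ≤ 4 * κ * (m * E.card) := by gcongr
  have r3 : 18 * κ * ∑ k, l1Norm (D k) ^ 2 ≤ 18 * κ * (4 * m * L) := by
    have h0 : 4 * m ^ 2 * L * n ≤ 4 * m * L := by
      calc 4 * m ^ 2 * L * n = 4 * m * L * (m * n) := by ring
        _ ≤ 4 * m * L * 1 := by gcongr
        _ = _ := by ring
    have := hDsum.trans h0
    gcongr
  have e : m * n * (κ * (16 / L + 72 * L / n)) =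
      2 * (4 * κ * (m * (2 * n / L))) + 18 * κ * (4 * m * L) := by
    field_simp
    ring
  rw [e]
  linarith

/-- A combination of at most `2 ^ r` permutations can be replaced by a single permutation, almost
without increasing a quartic form. -/
lemma exists_perm_quarticForm_le [Nonempty V] {κ : ℝ} {K : V × V → V × V → V × V → V × V → ℝ}
    (hκ : 0 ≤ κ) (hK : ∀ a b c d, |K a b c d| ≤ κ) {ι : Type*} {w : ι → ℝ} (hw : ∀ t, 0 ≤ w t)
    (σ : ι → Equiv.Perm V) {L : ℕ} (hL : 0 < L) (r : ℕ) :
    ∀ (s : Finset ι) (Z : V × V → ℝ), s.card ≤ 2 ^ r → (∀ a, 0 ≤ Z a) →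
      ∑ a, Z a + (∑ t ∈ s, w t) * Fintype.card V ≤ 1 →
    ∃ τ : Equiv.Perm V,
      quarticForm K (Z + (∑ t ∈ s, w t) • permIndicator τ) (Z + (∑ t ∈ s, w t) • permIndicator τ)
          (Z + (∑ t ∈ s, w t) • permIndicator τ) (Z + (∑ t ∈ s, w t) • permIndicator τ) ≤
        quarticForm K (Z + ∑ t ∈ s, w t • permIndicator (σ t))
          (Z + ∑ t ∈ s, w t • permIndicator (σ t)) (Z + ∑ t ∈ s, w t • permIndicator (σ t))
          (Z + ∑ t ∈ s, w t • permIndicator (σ t)) +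
        r * ((∑ t ∈ s, w t) * Fintype.card V * (κ * (16 / L + 72 * L / Fintype.card V))) := by
  classical
  induction r with
  | zero =>
    intro s Z hs hZ hmass
    rw [pow_zero, Nat.le_one_iff_eq_zero_or_eq_one, Finset.card_eq_zero, Finset.card_eq_one] at hs
    rcases hs with rfl | ⟨t, rfl⟩
    · exact ⟨1, by simp⟩
    · exact ⟨σ t, by simp⟩
  | succ r ih =>
    intro s Z hs hZ hmass
    obtain ⟨s₁, hs₁, hcard⟩ := Finset.exists_subset_card_eq (min_le_right (2 ^ r) s.card)
    have hc₁ : s₁.card ≤ 2 ^ r := hcard.trans_le (min_le_left _ _)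
    have hc₂ : (s \ s₁).card ≤ 2 ^ r := by
      rw [Finset.card_sdiff_of_subset hs₁, hcard]
      rw [pow_succ] at hs
      omega
    have hsum : ∑ t ∈ s, w t = ∑ t ∈ s₁, w t + ∑ t ∈ s \ s₁, w t := by
      rw [add_comm, Finset.sum_sdiff hs₁]
    have hsum' : ∑ t ∈ s, w t • permIndicator (σ t) =
        ∑ t ∈ s₁, w t • permIndicator (σ t) + ∑ t ∈ s \ s₁, w t • permIndicator (σ t) := by
      rw [add_comm, Finset.sum_sdiff hs₁]
    have hmass_perm : ∀ (c : ℝ) (τ : Equiv.Perm V),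
        ∑ a, (c • permIndicator τ) a = c * Fintype.card V := by
      intro c τ
      have := sum_permIndicator_mul τ fun _ => c
      simp only [Finset.sum_const, Finset.card_univ, nsmul_eq_mul] at this
      simp only [Pi.smul_apply, smul_eq_mul, mul_comm c, this]
    have hmass_sum : ∑ a, (∑ t ∈ s \ s₁, w t • permIndicator (σ t)) a =
        (∑ t ∈ s \ s₁, w t) * Fintype.card V := by
      simp only [Finset.sum_apply]
      rw [Finset.sum_comm, Finset.sum_mul]
      exact Finset.sum_congr rfl fun t _ => hmass_perm _ _
    have hl₁ : 0 ≤ ∑ t ∈ s₁, w t := Finset.sum_nonneg fun t _ => hw t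
    have hl₂ : 0 ≤ ∑ t ∈ s \ s₁, w t := Finset.sum_nonneg fun t _ => hw t
    obtain ⟨τ₁, h₁⟩ := ih s₁ (Z + ∑ t ∈ s \ s₁, w t • permIndicator (σ t)) hc₁
      (fun a => add_nonneg (hZ a) (by
        rw [Finset.sum_apply]
        exact Finset.sum_nonneg fun t _ => mul_nonneg (hw t) (permIndicator_nonneg _ _)))
      (by
        simp only [Pi.add_apply, Finset.sum_add_distrib]
        rw [hmass_sum]
        rw [hsum] at hmass
        linarith)
    obtain ⟨τ₂, h₂⟩ := ih (s \ s₁) (Z + (∑ t ∈ s₁, w t) • permIndicator τ₁) hc₂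
      (fun a => add_nonneg (hZ a) (mul_nonneg hl₁ (permIndicator_nonneg _ _)))
      (by
        simp only [Pi.add_apply, Finset.sum_add_distrib]
        rw [hmass_perm]
        rw [hsum] at hmass
        linarith)
    obtain ⟨τ, h⟩ := exists_merge_quarticForm_le hκ hK hZ τ₁ τ₂ hl₁ hl₂ (by rwa [← hsum]) hL
    refine ⟨τ, ?_⟩
    have e₁ : Z + ∑ t ∈ s \ s₁, w t • permIndicator (σ t) +
        ∑ t ∈ s₁, w t • permIndicator (σ t) = Z + ∑ t ∈ s, w t • permIndicator (σ t) := by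
      rw [hsum']; abel
    have e₂ : Z + ∑ t ∈ s \ s₁, w t • permIndicator (σ t) +
        (∑ t ∈ s₁, w t) • permIndicator τ₁ =
        Z + (∑ t ∈ s₁, w t) • permIndicator τ₁ +
          ∑ t ∈ s \ s₁, w t • permIndicator (σ t) := by abel
    rw [e₁, e₂] at h₁
    rw [add_assoc Z _ ((∑ t ∈ s \ s₁, w t) • permIndicator τ₂)] at h₂
    rw [hsum]
    push_cast
    linarith

/-- A doubly stochastic matrix is a combination of at most `n ^ 2 + 1` permutation matrices. -/
lemma exists_eq_sum_permIndicator [Nonempty V] {x : V × V → ℝ} (hx : ∀ a, 0 ≤ x a)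
    (hrow : ∀ i, ∑ u, x (i, u) = 1 / Fintype.card V)
    (hcol : ∀ u, ∑ i, x (i, u) = 1 / Fintype.card V) :
    ∃ (ι : Type u) (_ : Fintype ι) (w : ι → ℝ) (σ : ι → Equiv.Perm V), (∀ t, 0 ≤ w t) ∧
      ∑ t, w t = 1 / Fintype.card V ∧ Fintype.card ι ≤ Fintype.card V ^ 2 + 1 ∧
      x = ∑ t, w t • permIndicator (σ t) := by
  set n : ℝ := (Fintype.card V : ℝ)
  have hn : 0 < n := Nat.cast_pos.2 Fintype.card_pos
  have hM : (Matrix.of fun i u => n * x (i, u)) ∈ doublyStochastic ℝ V := by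
    rw [mem_doublyStochastic_iff_sum]
    refine ⟨fun i j => mul_nonneg hn.le (hx _), fun i => ?_, fun j => ?_⟩
    · simp only [Matrix.of_apply, ← Finset.mul_sum, hrow]
      field_simp
    · simp only [Matrix.of_apply, ← Finset.mul_sum, hcol]
      field_simp
  rw [← SetLike.mem_coe, doublyStochastic_eq_convexHull_permMatrix] at hM
  obtain ⟨ι, _, z, w, hz, hind, hw, hw1, hsum⟩ := eq_pos_convex_span_of_mem_convexHull hM
  have hz' : ∀ t, ∃ σ : Equiv.Perm V, Equiv.Perm.permMatrix ℝ σ = z t := fun t =>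
    hz (Set.mem_range_self t)
  choose σ hσ using hz'
  refine ⟨ι, inferInstance, fun t => w t / n, σ, fun t => div_nonneg (hw t).le hn.le, ?_, ?_, ?_⟩
  · rw [← Finset.sum_div, hw1]
  · refine hind.card_le_finrank_succ.trans (Nat.succ_le_succ ?_)
    refine (Submodule.finrank_le _).trans (le_of_eq ?_)
    rw [Module.finrank_matrix, Module.finrank_self, mul_one, pow_two]
  · funext a
    have h := congrFun (congrFun hsum a.1) a.2
    simp only [Matrix.of_apply, Matrix.sum_apply, Matrix.smul_apply, ← hσ, smul_eq_mul] at h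
    have h2 : x a = n⁻¹ * (n * x (a.1, a.2)) := by
      rw [inv_mul_cancel_left₀ hn.ne']
    rw [h2, ← h, Finset.mul_sum, Finset.sum_apply]
    refine Finset.sum_congr rfl fun t _ => ?_
    have h3 : Equiv.Perm.permMatrix ℝ (σ t) a.1 a.2 = permIndicator (σ t) a := by
      simp [Equiv.Perm.permMatrix, PEquiv.toMatrix_apply, Equiv.toPEquiv_apply, permIndicator]
    rw [h3, Pi.smul_apply, smul_eq_mul]
    ring

end Merge

section CutOfPermutation

universe u

variable {V : Type u} [Fintype V] [DecidableEq V]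

/-- If a permutation has a large weight in a coupling, then the cut norm along this permutation is
bounded in terms of the cut norm of the overlaid kernel. -/
lemma abs_cut_perm_le_of_le_weight {n : ℝ} (hn : 0 < n) {W : V × V → V × V → ℝ}
    {x : V × V → ℝ} {ε N : ℝ} (hN : 0 < N) (σ : Equiv.Perm V) (hσ : ∀ i, 1 / (n * N) ≤ x (i, σ i))
    (hε : ∀ S T : Finset (V × V), |∑ a ∈ S, ∑ b ∈ T, x a * x b * W a b| ≤ ε) (S T : Finset V) :
    |∑ i ∈ S, ∑ j ∈ T, W (i, σ i) (j, σ j)| / n ^ 2 ≤ 4 * N ^ 2 * ε := by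
  let f : Finset V → V × V → ℝ := fun U a =>
    if σ a.1 = a.2 then (if a.1 ∈ U then 1 / (n * x a) else 0) else 0
  have hpos : ∀ a : V × V, σ a.1 = a.2 → 0 < x a ∧ 1 / (n * x a) ≤ N := by
    rintro ⟨i, u⟩ h
    obtain rfl : σ i = u := h
    have h1 := hσ i
    have h2 : 0 < x (i, σ i) := lt_of_lt_of_le (by positivity) h1
    refine ⟨h2, ?_⟩
    rw [div_le_iff₀ (by positivity)] at h1 ⊢
    linarith
  have hf : ∀ U a, |f U a| ≤ N := by
    intro U a
    simp only [f]
    split_ifs with h1 h2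
    · have := (hpos a h1).1
      rw [abs_of_nonneg (by positivity)]
      exact (hpos a h1).2
    · simpa using hN.le
    · simpa using hN.le
  have hfx : ∀ U a, f U a * x a = permIndicator σ a * (if a.1 ∈ U then 1 / n else 0) := by
    intro U a
    simp only [f, permIndicator]
    split_ifs with h1 h2
    · have := (hpos a h1).1
      field_simp
    · simp
    · simp
    · simp
  have h := abs_bilin_le_of_cut_le hε (hf S) (hf T) hN.le hN.le
  have e : ∑ a, ∑ b, f S a * f T b * (x a * x b * W a b) =
      (∑ i ∈ S, ∑ j ∈ T, W (i, σ i) (j, σ j)) / n ^ 2 := by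
    have e1 : ∀ a b, f S a * f T b * (x a * x b * W a b) = permIndicator σ a *
        (permIndicator σ b * ((if a.1 ∈ S then 1 / n else 0) *
          ((if b.1 ∈ T then 1 / n else 0) * W a b))) := by
      intro a b
      calc _ = (f S a * x a) * ((f T b * x b) * W a b) := by ring
        _ = _ := by rw [hfx, hfx]; ring
    simp only [e1, ← Finset.mul_sum, sum_permIndicator_mul]
    simp only [ite_mul, zero_mul, Finset.sum_ite_mem, Finset.univ_inter, ← Finset.mul_sum]
    ring
  rw [e, abs_div, abs_of_nonneg (sq_nonneg n)] at h
  linarith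

/-- A fractional overlay can be replaced by a permutation, at the cost of a power in the cut norm. -/
theorem exists_perm_cut_le [Nonempty V] {A B : V → V → ℝ} (hA : ∀ i j, |A i j| ≤ 1)
    (hB : ∀ i j, |B i j| ≤ 1) {x : V × V → ℝ} (hx : ∀ a, 0 ≤ x a)
    (hrow : ∀ i, ∑ u, x (i, u) = 1 / Fintype.card V)
    (hcol : ∀ u, ∑ i, x (i, u) = 1 / Fintype.card V) {ε : ℝ}
    (hε : ∀ S T : Finset (V × V),
      |∑ a ∈ S, ∑ b ∈ T, x a * x b * (A a.1 b.1 - B a.2 b.2)| ≤ ε) :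
    ∃ σ : Equiv.Perm V, ∀ S T : Finset V,
      |∑ i ∈ S, ∑ j ∈ T, (A i j - B (σ i) (σ j))| / (Fintype.card V : ℝ) ^ 2 ≤
        32 * ε ^ ((1 : ℝ) / 67) := by
  have hε0 : 0 ≤ ε := by simpa using hε ∅ ∅
  let W : V × V → V × V → ℝ := fun a b => A a.1 b.1 - B a.2 b.2
  have hW : ∀ a b, |W a b| ≤ 2 := fun a b =>
    (abs_sub _ _).trans (by linarith [hA a.1 b.1, hB a.2 b.2])
  set y : ℝ := ε ^ ((1 : ℝ) / 67)
  have hy0 : 0 ≤ y := Real.rpow_nonneg hε0 _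
  have hy : y ^ 67 = ε := by
    rw [← Real.rpow_natCast, ← Real.rpow_mul hε0]
    norm_num
  obtain ⟨ι, _, w, σ, hw, hw1, hcard, hsum⟩ := exists_eq_sum_permIndicator hx hrow hcol
  set n : ℝ := (Fintype.card V : ℝ) with hndef
  have hn1 : 1 ≤ n := Nat.one_le_cast.2 Fintype.card_pos
  have hn : 0 < n := by linarith
  rcases le_or_gt (1 / 16) y with hbig | hsmall
  · refine ⟨1, fun S T => ?_⟩
    rw [div_le_iff₀ (by positivity)]
    calc |∑ i ∈ S, ∑ j ∈ T, (A i j - B ((1 : Equiv.Perm V) i) ((1 : Equiv.Perm V) j))|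
        ≤ ∑ i ∈ S, ∑ j ∈ T, (2 : ℝ) := by
          refine (Finset.abs_sum_le_sum_abs _ _).trans (Finset.sum_le_sum fun i _ => ?_)
          refine (Finset.abs_sum_le_sum_abs _ _).trans (Finset.sum_le_sum fun j _ => ?_)
          exact hW (i, i) (j, j)
      _ = 2 * (S.card * T.card) := by simp only [Finset.sum_const, nsmul_eq_mul]; ring
      _ ≤ 2 * (n * n) := by
          have h1 : (S.card : ℝ) ≤ n := Nat.cast_le.2 (Finset.card_le_univ S)
          have h2 : (T.card : ℝ) ≤ n := Nat.cast_le.2 (Finset.card_le_univ T)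
          gcongr
      _ ≤ 32 * y * n ^ 2 := by
          rw [← pow_two]
          have : 2 ≤ 32 * y := by linarith
          gcongr
  rcases le_or_gt (16 * n ^ 4 * ε) (32 * y) with hfew | hmany
  · have ht : ∃ t, 1 / (n * (n ^ 2 + 1)) ≤ w t := by
      by_contra! hcon
      have hne : (Finset.univ : Finset ι).Nonempty := by
        rw [Finset.univ_nonempty_iff]
        by_contra hemp
        rw [not_nonempty_iff] at hemp
        rw [Finset.univ_eq_empty, Finset.sum_empty] at hw1
        exact (one_div_pos.2 hn).ne hw1
      have h1 := Finset.sum_lt_sum_of_nonempty hne fun t _ => hcon t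
      rw [hw1, Finset.sum_const, Finset.card_univ, nsmul_eq_mul] at h1
      have h2 : (Fintype.card ι : ℝ) ≤ n ^ 2 + 1 := by
        have : (Fintype.card ι : ℝ) ≤ ((Fintype.card V ^ 2 + 1 : ℕ) : ℝ) := Nat.cast_le.2 hcard
        push_cast at this
        exact this
      have h3 : (Fintype.card ι : ℝ) * (1 / (n * (n ^ 2 + 1))) ≤
          (n ^ 2 + 1) * (1 / (n * (n ^ 2 + 1))) := by gcongr
      have h4 : (n ^ 2 + 1) * (1 / (n * (n ^ 2 + 1))) = 1 / n := by
        field_simp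
      linarith
    obtain ⟨t, ht⟩ := ht
    refine ⟨σ t, fun S T => ?_⟩
    have h0 : ∀ i, 1 / (n * (n ^ 2 + 1)) ≤ x (i, σ t i) := by
      intro i
      refine ht.trans ?_
      rw [hsum, Finset.sum_apply]
      have h1 := Finset.single_le_sum (f := fun s => (w s • permIndicator (σ s)) (i, σ t i))
        (fun s _ => mul_nonneg (hw s) (permIndicator_nonneg _ _)) (Finset.mem_univ t)
      refine le_trans (le_of_eq ?_) h1
      simp [permIndicator]
    refine (abs_cut_perm_le_of_le_weight (W := W) hn (by positivity) (σ t) h0 hε S T).trans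
      (le_trans ?_ hfew)
    have h5 : 1 ≤ n ^ 2 := one_le_pow₀ hn1
    have h6 : (n ^ 2 + 1) ^ 2 ≤ (2 * n ^ 2) ^ 2 := by gcongr; linarith
    have h7 : 4 * (n ^ 2 + 1) ^ 2 ≤ 16 * n ^ 4 := by nlinarith
    gcongr
  · have hypos : 0 < y := by
      rcases hy0.eq_or_lt with h | h
      · rw [← hy, ← h] at hmany
        norm_num at hmany
      · exact h
    let q := Nat.sqrt (Nat.sqrt (Fintype.card V))
    have hq4 : q ^ 2 * q ^ 2 ≤ Fintype.card V :=
      le_trans (Nat.mul_le_mul (Nat.sqrt_le' _) (Nat.sqrt_le' _)) (Nat.sqrt_le _)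
    have hq5 : Fintype.card V + 1 ≤ (q + 1) ^ 4 := by
      have h1 := Nat.lt_succ_sqrt' (Fintype.card V)
      have h2 : Nat.sqrt (Fintype.card V) + 1 ≤ (q + 1) ^ 2 :=
        Nat.lt_succ_sqrt' (Nat.sqrt (Fintype.card V))
      have h3 := Nat.pow_le_pow_left h2 2
      rw [← pow_mul] at h3
      exact le_trans h1 h3
    have hq : 0 < q := Nat.sqrt_pos.2 (Nat.sqrt_pos.2 Fintype.card_pos)
    have hcard' : (Finset.univ : Finset ι).card ≤ 2 ^ (8 * q) := by
      rw [Finset.card_univ]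
      have h1 : q + 1 ≤ 2 ^ q := Nat.lt_two_pow_self
      calc Fintype.card ι ≤ Fintype.card V ^ 2 + 1 := hcard
        _ ≤ (Fintype.card V + 1) ^ 2 := by nlinarith
        _ ≤ ((q + 1) ^ 4) ^ 2 := Nat.pow_le_pow_left hq5 2
        _ = (q + 1) ^ 8 := by ring
        _ ≤ (2 ^ q) ^ 8 := Nat.pow_le_pow_left h1 8
        _ = 2 ^ (8 * q) := by rw [← pow_mul, mul_comm]
    have hqr : (0 : ℝ) < q := Nat.cast_pos.2 hq
    have hqn : (q : ℝ) ^ 2 * (q : ℝ) ^ 2 ≤ n := by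
      have : ((q ^ 2 * q ^ 2 : ℕ) : ℝ) ≤ Fintype.card V := Nat.cast_le.2 hq4
      push_cast at this
      exact this
    have hnq : n ≤ (2 * q) ^ 4 := by
      have h1 : ((Fintype.card V + 1 : ℕ) : ℝ) ≤ (((q + 1) ^ 4 : ℕ) : ℝ) := Nat.cast_le.2 hq5
      push_cast at h1
      have h2 : (1 : ℝ) ≤ q := Nat.one_le_cast.2 hq
      have h3 : ((q : ℝ) + 1) ^ 4 ≤ (2 * q) ^ 4 := by gcongr; linarith
      linarith
    have hy66 : 2 < n ^ 4 * y ^ 66 := by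
      rw [← hy, show 16 * n ^ 4 * y ^ 67 = 16 * (n ^ 4 * y ^ 66) * y by ring] at hmany
      have := lt_of_mul_lt_mul_right hmany hypos.le
      linarith
    have hqy : 1 / (q : ℝ) ≤ 2 * y ^ 4 := by
      rw [div_le_iff₀ hqr]
      by_contra! hcon
      have h1 : (2 * y ^ 4 * q) ^ 16 < 1 := pow_lt_one₀ (by positivity) hcon (by norm_num)
      have h2 : n ^ 4 * y ^ 66 ≤ ((2 * q) ^ 4) ^ 4 * y ^ 66 := by gcongr
      have h3 : ((2 * (q : ℝ)) ^ 4) ^ 4 * y ^ 66 = (2 * y ^ 4 * q) ^ 16 * y ^ 2 := by ring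
      have h4 : y ^ 2 ≤ 1 := pow_le_one₀ hy0 (by linarith)
      have h5 : (2 * y ^ 4 * q) ^ 16 * y ^ 2 ≤ 1 * 1 := by gcongr
      linarith
    have hx1 : ∑ a, x a = 1 := by
      rw [Fintype.sum_prod_type]
      simp only [hrow, Finset.sum_const, Finset.card_univ, nsmul_eq_mul]
      exact mul_one_div_cancel hn.ne'
    obtain ⟨τ, hτ⟩ := exists_perm_quarticForm_le (K := fourCycleKernel W) (by positivity)
      (abs_fourCycleKernel_le hW) hw σ (L := q ^ 2) (by positivity) (8 * q) Finset.univ 0 hcard'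
      (fun _ => le_refl 0) (by
        rw [hw1]
        simp only [Pi.zero_apply, Finset.sum_const_zero, zero_add]
        exact (one_div_mul_cancel hn.ne').le)
    rw [zero_add, zero_add, ← hsum, hw1, ← hndef, one_div_mul_cancel hn.ne', one_mul,
      quarticForm_permIndicator] at hτ
    have hx2 := quarticForm_fourCycleKernel_le zero_le_two hW hx hx1 hε
    have herr : ((8 * q : ℕ) : ℝ) * (2 ^ 4 * (16 / ((q ^ 2 : ℕ) : ℝ) + 72 * ((q ^ 2 : ℕ) : ℝ) / n)) ≤
        11264 * (1 / q) := by
      push_cast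
      have h1 : 72 * (q : ℝ) ^ 2 / n ≤ 72 / (q : ℝ) ^ 2 := by
        rw [div_le_div_iff₀ hn (by positivity)]
        linarith
      calc 8 * (q : ℝ) * (2 ^ 4 * (16 / (q : ℝ) ^ 2 + 72 * (q : ℝ) ^ 2 / n))
          ≤ 8 * (q : ℝ) * (2 ^ 4 * (16 / (q : ℝ) ^ 2 + 72 / (q : ℝ) ^ 2)) := by gcongr
        _ = _ := by field_simp; norm_num
    have htotal : (1 / n) ^ 4 * ∑ i, ∑ j, ∑ k, ∑ l, fourCycleKernel W (i, τ i) (j, τ j) (k, τ k)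
        (l, τ l) ≤ (32 * y) ^ 4 := by
      have h1 : ε ≤ y ^ 4 := by
        rw [← hy]
        exact pow_le_pow_of_le_one hy0 (by linarith) (by norm_num)
      have h2 : 0 ≤ y ^ 4 := by positivity
      have h3 : (32 * y) ^ 4 = 1048576 * y ^ 4 := by ring
      rw [h3]
      linarith
    refine ⟨τ, fun S T => ?_⟩
    have hcut := cut_pow_four_le (fun i j => W (i, τ i) (j, τ j)) S T
    have hcut' : (|∑ i ∈ S, ∑ j ∈ T, W (i, τ i) (j, τ j)| / n ^ 2) ^ 4 ≤ (32 * y) ^ 4 := by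
      refine le_trans ?_ htotal
      rw [div_pow, Even.pow_abs (by decide), div_le_iff₀ (by positivity)]
      refine hcut.trans (le_of_eq ?_)
      rw [← hndef]
      field_simp
      rfl
    exact le_of_pow_le_pow_left₀ (by norm_num) (by positivity) hcut'

end CutOfPermutation

noncomputable section

namespace WeightedGraph

variable {V : Type*} {V' : Type*}

lemma le_cutDist [Fintype V] (G H : WeightedGraph V) (S T : Finset V) :
    |G.cutWeight S T - H.cutWeight S T| / G.totalWeight ^ 2 ≤ cutDist G H :=
  le_ciSup (f := fun p : Finset V × Finset V =>
    |G.cutWeight p.1 p.2 - H.cutWeight p.1 p.2| / G.totalWeight ^ 2)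
    (Set.finite_range _).bddAbove (S, T)

lemma cutDist_nonneg [Fintype V] (G H : WeightedGraph V) : 0 ≤ cutDist G H :=
  Real.iSup_nonneg fun _ => by positivity

lemma cutDist_eq_zero_of_isEmpty [Fintype V] [IsEmpty V] (G H : WeightedGraph V) :
    cutDist G H = 0 := by
  simp [cutDist, totalWeight]

lemma HasUnweightedNodes.totalWeight_eq [Fintype V] {G : WeightedGraph V}
    (hG : G.HasUnweightedNodes) : G.totalWeight = Fintype.card V := by
  simp [totalWeight, hG _]

lemma HasUnweightedNodes.relabel {G : WeightedGraph V} (hG : G.HasUnweightedNodes) (σ : V ≃ V') :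
    (G.relabel σ).HasUnweightedNodes := fun _ => hG _

lemma HasUnweightedNodes.normalize_nodeWeight [Fintype V] {G : WeightedGraph V}
    (hG : G.HasUnweightedNodes) (i : V) : G.normalize.nodeWeight i = 1 / Fintype.card V := by
  change G.nodeWeight i / G.totalWeight = _
  rw [hG.totalWeight_eq, hG i]

lemma HasUnweightedNodes.cutWeight_sub {G H : WeightedGraph V} (hG : G.HasUnweightedNodes)
    (hH : H.HasUnweightedNodes) (S T : Finset V) :
    G.cutWeight S T - H.cutWeight S T =
      ∑ i ∈ S, ∑ j ∈ T, (G.edgeWeight i j - H.edgeWeight i j) := by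
  simp only [cutWeight, hG _, hH _, one_mul, ← Finset.sum_sub_distrib]

lemma sum_mul_indicator_graph [Fintype V] [Fintype V'] [DecidableEq V] [DecidableEq V']
    (σ : V ≃ V') (S : Finset (V × V')) (c : ℝ) (F : V × V' → ℝ) :
    ∑ p ∈ S, (if σ p.1 = p.2 then c else 0) * F p =
      c * ∑ u with (σ.symm u, u) ∈ S, F (σ.symm u, u) := by
  have h : ∀ i u, (if (i, u) ∈ S then (if σ i = u then c else 0) * F (i, u) else 0) =
      if i = σ.symm u then (if (i, u) ∈ S then c * F (i, u) else 0) else 0 := by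
    intro i u
    simp only [Equiv.eq_symm_apply]
    split_ifs <;> simp
  rw [← Finset.univ_inter S, ← Finset.sum_ite_mem, Fintype.sum_prod_type_right]
  simp only [h, Finset.sum_ite_eq', Finset.mem_univ, if_true]
  rw [Finset.mul_sum, Finset.sum_filter, Finset.univ_inter]

/-- The fractional overlay that corresponds to a bijection of the node sets. -/
def FractionalOverlay.ofEquiv [Fintype V] [Fintype V'] [DecidableEq V] [DecidableEq V']
    {G : WeightedGraph V} {G' : WeightedGraph V'} (hG : G.HasUnweightedNodes)
    (hG' : G'.HasUnweightedNodes) (σ : V ≃ V') :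
    FractionalOverlay G.normalize G'.normalize where
  X i u := if σ i = u then 1 / (Fintype.card V : ℝ) else 0
  nonneg i u := by split_ifs <;> positivity
  row_sum i := by rw [hG.normalize_nodeWeight]; simp
  col_sum u := by
    rw [hG'.normalize_nodeWeight, ← Fintype.card_congr σ]
    simp [← Equiv.eq_symm_apply]

lemma FractionalOverlay.totalWeight_overlaidLeft [Fintype V] [Fintype V'] [Nonempty V]
    {G : WeightedGraph V} {G' : WeightedGraph V'} (hG : G.HasUnweightedNodes)
    (O : FractionalOverlay G.normalize G'.normalize) : O.overlaidLeft.totalWeight = 1 := by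
  have h : ∀ i, ∑ u, O.X i u = 1 / (Fintype.card V : ℝ) := fun i =>
    (O.row_sum i).trans (hG.normalize_nodeWeight i)
  simp only [totalWeight, overlaidLeft, Fintype.sum_prod_type, h]
  simp

lemma FractionalOverlay.cutWeight_sub [Fintype V] [Fintype V'] {G : WeightedGraph V}
    {G' : WeightedGraph V'} (O : FractionalOverlay G G') (S T : Finset (V × V')) :
    O.overlaidLeft.cutWeight S T - O.overlaidRight.cutWeight S T =
      ∑ p ∈ S, ∑ q ∈ T, O.X p.1 p.2 * O.X q.1 q.2 *
        (G.edgeWeight p.1 q.1 - G'.edgeWeight p.2 q.2) := by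
  simp only [cutWeight, overlaidLeft, overlaidRight, ← Finset.sum_sub_distrib, mul_sub]

lemma cutDist_ofEquiv_le [Fintype V] [Fintype V'] [DecidableEq V] [DecidableEq V']
    {G : WeightedGraph V} {G' : WeightedGraph V'} (hG : G.HasUnweightedNodes)
    (hG' : G'.HasUnweightedNodes) (σ : V ≃ V') :
    cutDist (FractionalOverlay.ofEquiv hG hG' σ).overlaidLeft
      (FractionalOverlay.ofEquiv hG hG' σ).overlaidRight ≤ cutDist (G.relabel σ) G' := by
  rcases isEmpty_or_nonempty V with hV | hV
  · rw [cutDist_eq_zero_of_isEmpty]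
    exact cutDist_nonneg _ _
  refine ciSup_le fun ⟨S, T⟩ => ?_
  refine le_trans (le_of_eq ?_) (le_cutDist (G.relabel σ) G'
    (Finset.univ.filter fun u => (σ.symm u, u) ∈ S) (Finset.univ.filter fun u => (σ.symm u, u) ∈ T))
  rw [FractionalOverlay.totalWeight_overlaidLeft hG, (hG.relabel σ).totalWeight_eq,
    (hG.relabel σ).cutWeight_sub hG', FractionalOverlay.cutWeight_sub, ← Fintype.card_congr σ]
  simp only [FractionalOverlay.ofEquiv, mul_assoc, ← Finset.mul_sum]
  simp only [sum_mul_indicator_graph]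
  simp only [← Finset.mul_sum, relabel, normalize]
  rw [abs_mul, abs_mul, abs_of_nonneg (by positivity : (0 : ℝ) ≤ 1 / Fintype.card V)]
  ring

lemma bddBelow_range_cutDist {ι : Sort*} [Fintype V] (G H : ι → WeightedGraph V) :
    BddBelow (Set.range fun t => cutDist (G t) (H t)) :=
  ⟨0, by rintro _ ⟨t, rfl⟩; exact cutDist_nonneg _ _⟩

lemma integerOverlayDist_le [Fintype V'] (G : WeightedGraph V) (G' : WeightedGraph V')
    (σ : V ≃ V') : integerOverlayDist G G' ≤ cutDist (G.relabel σ) G' :=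
  ciInf_le (bddBelow_range_cutDist (fun σ : V ≃ V' => G.relabel σ) fun _ => G') σ

/-- Every fractional overlay yields a relabeling. -/
lemma integerOverlayDist_le_cutDist_rpow [Fintype V] [Fintype V']
    (hcard : Fintype.card V = Fintype.card V') {G : WeightedGraph V} {G' : WeightedGraph V'}
    (hG : G.HasUnweightedNodes) (hG' : G'.HasUnweightedNodes)
    (hedge : ∀ i j, G.edgeWeight i j ∈ Set.Icc (-1 : ℝ) 1)
    (hedge' : ∀ u v, G'.edgeWeight u v ∈ Set.Icc (-1 : ℝ) 1)
    (O : FractionalOverlay G.normalize G'.normalize) :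
    integerOverlayDist G G' ≤ 32 * cutDist O.overlaidLeft O.overlaidRight ^ ((1 : ℝ) / 67) := by
  classical
  let e : V ≃ V' := Fintype.equivOfCardEq hcard
  rcases isEmpty_or_nonempty V with hV | hV
  · have hV' : IsEmpty V' := e.symm.isEmpty
    refine (integerOverlayDist_le G G' e).trans ?_
    rw [cutDist_eq_zero_of_isEmpty]
    have := Real.rpow_nonneg (cutDist_nonneg O.overlaidLeft O.overlaidRight) ((1 : ℝ) / 67)
    positivity
  obtain ⟨σ, hσ⟩ := exists_perm_cut_le (A := G.edgeWeight)
    (B := fun i j => G'.edgeWeight (e i) (e j)) (x := fun a : V × V => O.X a.1 (e a.2))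
    (ε := cutDist O.overlaidLeft O.overlaidRight) (fun i j => abs_le.2 (hedge i j))
    (fun i j => abs_le.2 (hedge' _ _)) (fun a => O.nonneg _ _)
    (fun i => by
      rw [Equiv.sum_comp e fun u => O.X i u, O.row_sum, hG.normalize_nodeWeight])
    (fun u => by
      refine (O.col_sum (e u)).trans ?_
      rw [hG'.normalize_nodeWeight, hcard])
    (fun S T => by
      have h := le_cutDist O.overlaidLeft O.overlaidRight
        (S.map ((Equiv.refl V).prodCongr e).toEmbedding)
        (T.map ((Equiv.refl V).prodCongr e).toEmbedding)
      rw [FractionalOverlay.totalWeight_overlaidLeft hG, FractionalOverlay.cutWeight_sub, one_pow,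
        div_one] at h
      simpa only [Finset.sum_map, Equiv.coe_toEmbedding, Equiv.prodCongr_apply, Equiv.coe_refl,
        Prod.map_fst, Prod.map_snd, id_eq, normalize] using h)
  refine (integerOverlayDist_le G G' (σ.trans e)).trans (ciSup_le fun ⟨S, T⟩ => ?_)
  refine le_trans (le_of_eq ?_) (hσ (S.map (σ.trans e).symm.toEmbedding)
    (T.map (σ.trans e).symm.toEmbedding))
  have hcancel : ∀ u, e (σ ((σ.trans e).symm u)) = u := fun u => (σ.trans e).apply_symm_apply u
  rw [(hG.relabel _).totalWeight_eq, (hG.relabel _).cutWeight_sub hG', hcard]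
  simp only [Finset.sum_map, Equiv.coe_toEmbedding, hcancel, relabel]

end WeightedGraph

end

theorem theorem2p1 {V₁ V₂ : Type*} [Fintype V₁] [Fintype V₂]
    (hcard : Fintype.card V₁ = Fintype.card V₂)
    (G₁ : WeightedGraph V₁) (G₂ : WeightedGraph V₂)
    (hnode₁ : G₁.HasUnweightedNodes) (hnode₂ : G₂.HasUnweightedNodes)
    (hedge₁ : ∀ i j, G₁.edgeWeight i j ∈ Set.Icc (-1 : ℝ) 1)
    (hedge₂ : ∀ u v, G₂.edgeWeight u v ∈ Set.Icc (-1 : ℝ) 1) :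
    WeightedGraph.fractionalOverlayDist G₁ G₂ ≤ WeightedGraph.integerOverlayDist G₁ G₂ ∧
    WeightedGraph.integerOverlayDist G₁ G₂ ≤
      32 * (WeightedGraph.fractionalOverlayDist G₁ G₂) ^ ((1 : ℝ) / 67) := by
  classical
  have e : V₁ ≃ V₂ := Fintype.equivOfCardEq hcard
  have hne : Nonempty (V₁ ≃ V₂) := ⟨e⟩
  have hneO : Nonempty (WeightedGraph.FractionalOverlay G₁.normalize G₂.normalize) :=
    ⟨WeightedGraph.FractionalOverlay.ofEquiv hnode₁ hnode₂ e⟩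
  refine ⟨le_ciInf fun σ => ?_, ?_⟩
  · exact (ciInf_le (WeightedGraph.bddBelow_range_cutDist
      (fun O : WeightedGraph.FractionalOverlay G₁.normalize G₂.normalize => O.overlaidLeft)
      fun O => O.overlaidRight) _).trans (WeightedGraph.cutDist_ofEquiv_le hnode₁ hnode₂ σ)
  · set d := WeightedGraph.integerOverlayDist G₁ G₂
    have hd : 0 ≤ d := Real.iInf_nonneg fun _ => WeightedGraph.cutDist_nonneg _ _
    have h : (d / 32) ^ 67 ≤ WeightedGraph.fractionalOverlayDist G₁ G₂ := by
      refine le_ciInf fun O => ?_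
      have h1 := WeightedGraph.integerOverlayDist_le_cutDist_rpow hcard hnode₁ hnode₂ hedge₁
        hedge₂ O
      have h2 := WeightedGraph.cutDist_nonneg O.overlaidLeft O.overlaidRight
      have h3 : d / 32 ≤ WeightedGraph.cutDist O.overlaidLeft O.overlaidRight ^ ((1 : ℝ) / 67) := by
        rw [div_le_iff₀ (by norm_num)]
        linarith
      refine (pow_le_pow_left₀ (by positivity) h3 67).trans (le_of_eq ?_)
      rw [← Real.rpow_natCast, ← Real.rpow_mul h2]
      norm_num
    have h4 := Real.rpow_le_rpow (by positivity) h (by norm_num : (0 : ℝ) ≤ 1 / 67)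
    rw [← Real.rpow_natCast, ← Real.rpow_mul (by positivity)] at h4
    norm_num at h4
    norm_num
    linarith
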